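/- There is an absolute constant $\kappa>0$, and for every $c>0$ there is a constant $C>0$ depending only on $c$, such that the following holds for all integers $m,L\ge 1$ and all real $\tau$ with $0\le\tau\le \frac{1}{C\sqrt L}$. Let $W_1,\dots,W_L\in\mathbb{R}^{m\times m}$ be random matrices all of whose entries are independent with law $\mathcal N(0,\frac2m)$, and let $D_1,\dots,D_L\in\mathbb{R}^{m\times m}$ be random diagonal matrices on the same probability space such that almost surely $\|D_l\|_2\le 1$ for all $l$, and such that no $D_l$ looks ahead: for every $l\in\{1,\dots,L\}$ the family $(W_1,\dots,W_l,D_1,\dots,D_l)$ is jointly independent of the later weights $(W_{l+1},\dots,W_L)$. Then, with probability at least $1-L^2\exp(-\kappa m c^2)$, simultaneously for all $1\le a\le b\le L$, $$\left\|D_b(I+\tau W_b)\,D_{b-1}(I+\tau W_{b-1})\cdots D_a(I+\tau W_a)\right\|_2\le 1+c,$$ where $\|\cdot\|_2$ denotes the spectral norm. -/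

import Mathlib

open MeasureTheory ProbabilityTheory
open scoped NNReal

/-- The spectral norm `‖M‖₂`: the operator norm of `M` on Euclidean space. -/
noncomputable def specNorm {m : ℕ} (M : Matrix (Fin m) (Fin m) ℝ) : ℝ :=
  ‖Matrix.toEuclideanCLM (n := Fin m) (𝕜 := ℝ) M‖

/-- `resProd τ D W a b` is the product
`D_b (I + τ W_b) D_{b-1} (I + τ W_{b-1}) ⋯ D_a (I + τ W_a)`, for `1 ≤ a ≤ b`
(and the empty product `I` if `b < a`). -/
noncomputable def resProd {m : ℕ} (τ : ℝ) (D W : ℕ → Matrix (Fin m) (Fin m) ℝ) (a : ℕ) :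
    ℕ → Matrix (Fin m) (Fin m) ℝ
  | 0 => 1
  | b + 1 => if a ≤ b + 1 then D (b + 1) * (1 + τ • W (b + 1)) * resProd τ D W a b else 1

/-- Gaussian initialization: all entries of `W_1, …, W_L` are independent, and each of them has
law `N(0, 2/m)`. -/
structure IsGaussianInit {Ω : Type*} [MeasurableSpace Ω] (P : Measure Ω) (L m : ℕ)
    (W : ℕ → Ω → Matrix (Fin m) (Fin m) ℝ) : Prop where
  measurable : ∀ l ∈ Set.Icc 1 L, ∀ i j, Measurable fun ω => W l ω i j
  law : ∀ l ∈ Set.Icc 1 L, ∀ i j,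
    P.map (fun ω => W l ω i j) = gaussianReal 0 (2 / (m : ℝ≥0))
  indep : iIndepFun (fun (e : Set.Icc 1 L × Fin m × Fin m) ω => W e.1 ω e.2.1 e.2.2) P

/-- `D_1, …, D_L` are random diagonal matrices of spectral norm at most `1` that do not look ahead:
for every layer `l`, the matrices produced up to layer `l`, i.e. `(W_1, …, W_l, D_1, …, D_l)`, are
jointly independent of the later weights `(W_{l+1}, …, W_L)`. -/
structure IsAdaptedDiag {Ω : Type*} [MeasurableSpace Ω] (P : Measure Ω) (L m : ℕ)
    (W D : ℕ → Ω → Matrix (Fin m) (Fin m) ℝ) : Prop where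
  measurable : ∀ l ∈ Set.Icc 1 L, ∀ i j, Measurable fun ω => D l ω i j
  isDiag : ∀ l ∈ Set.Icc 1 L, ∀ᵐ ω ∂P, (D l ω).IsDiag
  norm_le : ∀ l ∈ Set.Icc 1 L, ∀ᵐ ω ∂P, specNorm (D l ω) ≤ 1
  indep : ∀ l ∈ Set.Icc 1 L,
    IndepFun
      (fun ω => ((fun (k : Set.Icc 1 l) (i j : Fin m) => W k ω i j),
        (fun (k : Set.Icc 1 l) (i j : Fin m) => D k ω i j)))
      (fun ω (k : Set.Ioc l L) (i j : Fin m) => W k ω i j) P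

/-!
The spectral norm of a product is controlled through a moment of very high order, `2 * m * q`, where
`q` depends on `c` only; no net of the sphere is needed.

Fix `a` and a vector `x`, and let `h_b` be the image of `x` under the product of the layers
`a, …, b`. As `D_{b+1}` is a contraction, `‖h_{b+1}‖ ≤ ‖(I + τ W_{b+1}) h_b‖`, and `W_{b+1}` is
independent of `h_b` because no `D_l` looks ahead. For a deterministic unit vector `u`, the
coordinates `Y_i` of `W u` are independent with law `N(0, 2/m)`, so that with `p = m * q`
`E ‖u + τ W u‖ ^ (2p) ≤ E exp (p ∑ i, (2 τ u_i Y_i + τ ^ 2 Y_i ^ 2))`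
splits into explicit one-dimensional Gaussian integrals, and is at most
`exp (m (4 q + 8 q ^ 2) τ ^ 2)` (`lintegral_normSq_pow_le`). Over at most `L` layers, with
`L τ ^ 2 ≤ 1 / C ^ 2` and `C` large in terms of `q`, this gives `E ‖h_b‖ ^ (2p) ≤ exp m * ‖x‖ ^ (2p)`
(`lintegral_norm_resProd_pow_le`).

To pass from fixed vectors to the norm, integrate `‖A x‖ ^ (2p)` over the unit ball. If
`‖A‖ > 1 + c`, then `‖A x‖ ≥ (1 - 3 ε) (1 + c)` on a whole ball of radius `ε` inside the unit ball
(`le_lintegral_closedBall_norm_pow`), so the integral is at least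
`ε ^ m ((1 - 3 ε) (1 + c)) ^ (2p)` times the volume of the unit ball. Choosing `ε` with
`(1 - 3 ε) (1 + c) = 1 + c / 2` and then `q` large, this beats `exp m` by the factor
`exp (m * c ^ 2)`; Fubini and Markov bound the probability of `‖A‖ > 1 + c` by `exp (-m * c ^ 2)`.
A union bound over the pairs `(a, b)` concludes, with `κ = 1`.
-/

/-! ### Gaussian integrals -/

theorem inv_sqrt_one_sub_two_mul_le_exp {x : ℝ} (h0 : 0 ≤ x) (h1 : x ≤ 1 / 4) :
    (√(1 - 2 * x))⁻¹ ≤ Real.exp (2 * x) := by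
  have hpos : 0 < 1 - 2 * x := by linarith
  rw [inv_le_comm₀ (Real.sqrt_pos.2 hpos) (Real.exp_pos _), ← Real.exp_neg]
  apply Real.le_sqrt_of_sq_le
  rw [← Real.exp_nat_mul, show ((2 : ℕ) : ℝ) * -(2 * x) = -(4 * x) by push_cast; ring, Real.exp_neg]
  rw [inv_le_comm₀ (Real.exp_pos _) hpos]
  refine le_trans ?_ (Real.add_one_le_exp (4 * x))
  rw [inv_le_iff_one_le_mul₀ hpos]
  nlinarith

/-- The exact value of the integral is `(1 - 2 a v) ^ (-1/2) * exp (b ^ 2 v / (2 (1 - 2 a v)))`: the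
integrand times the density is a multiple of another Gaussian density. -/
theorem lintegral_exp_linear_add_sq_gaussianReal_le {v : ℝ≥0} (hv : v ≠ 0) (a b : ℝ)
    (ha : 0 ≤ a) (hav : a * v ≤ 1 / 4) :
    ∫⁻ y, ENNReal.ofReal (Real.exp (b * y + a * y ^ 2)) ∂gaussianReal 0 v ≤
      ENNReal.ofReal (Real.exp (2 * (a * v) + b ^ 2 * v)) := by
  have hv0 : (0 : ℝ) < v := by positivity
  have hx0 : 0 ≤ a * v := by positivity
  set r : ℝ := 1 - 2 * (a * v) with hr
  have hr0 : 1 / 2 ≤ r := by rw [hr]; linarith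
  have hrpos : 0 < r := by linarith
  set v' : ℝ≥0 := ⟨v / r, by positivity⟩ with hv'
  have hv'c : (v' : ℝ) = v / r := rfl
  have hv'0 : v' ≠ 0 := by
    rw [← NNReal.coe_ne_zero, hv'c]; positivity
  -- Completing the square gives the Gaussian density of variance `v / r` and mean `b * (v / r)`.
  have key : ∀ y : ℝ, gaussianPDF 0 v y * ENNReal.ofReal (Real.exp (b * y + a * y ^ 2)) =
      ENNReal.ofReal ((√r)⁻¹ * Real.exp (b ^ 2 * v / (2 * r))) * gaussianPDF (b * (v / r)) v' y := by
    intro y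
    rw [gaussianPDF, gaussianPDF, ← ENNReal.ofReal_mul (gaussianPDFReal_nonneg _ _ _),
      ← ENNReal.ofReal_mul (by positivity), gaussianPDFReal, gaussianPDFReal, hv'c]
    congr 1
    have h1 : √(2 * Real.pi * (v / r)) = √(2 * Real.pi * v) * (√r)⁻¹ := by
      rw [← mul_div_assoc, Real.sqrt_div (by positivity), div_eq_mul_inv]
    have h2 : Real.exp (-(y - 0) ^ 2 / (2 * v)) * Real.exp (b * y + a * y ^ 2) =
        Real.exp (b ^ 2 * v / (2 * r)) * Real.exp (-(y - b * (v / r)) ^ 2 / (2 * (v / r))) := by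
      rw [← Real.exp_add, ← Real.exp_add]
      congr 1
      have : a = (1 - r) / (2 * v) := by rw [hr]; field_simp; ring
      rw [this]
      field_simp
      ring
    have hs : √r ≠ 0 := (Real.sqrt_pos.2 hrpos).ne'
    rw [h1, mul_assoc, h2, mul_inv, inv_inv]
    field_simp
  rw [gaussianReal_of_var_ne_zero _ hv, lintegral_withDensity_eq_lintegral_mul _
    (measurable_gaussianPDF _ _) (by fun_prop)]
  simp only [Pi.mul_apply, key]
  rw [lintegral_const_mul _ (measurable_gaussianPDF _ _), lintegral_gaussianPDF_eq_one _ hv'0, mul_one]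
  apply ENNReal.ofReal_le_ofReal
  rw [Real.exp_add]
  gcongr
  · exact inv_sqrt_one_sub_two_mul_le_exp hx0 hav
  · rw [div_le_iff₀ (by positivity)]
    have : 0 ≤ b ^ 2 * v := by positivity
    nlinarith

theorem map_sum_eq_gaussianReal {Ω ι : Type*} [MeasurableSpace Ω] {P : Measure Ω}
    [IsProbabilityMeasure P] {X : ι → Ω → ℝ} {v : ι → ℝ≥0}
    (hX : ∀ i, Measurable (X i)) (hlaw : ∀ i, P.map (X i) = gaussianReal 0 (v i))
    (hind : iIndepFun X P) (s : Finset ι) :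
    P.map (fun ω => ∑ i ∈ s, X i ω) = gaussianReal 0 (∑ i ∈ s, v i) := by
  classical
  induction s using Finset.induction_on with
  | empty => simp [Measure.map_const]
  | insert i s hi ih =>
    have h := gaussianReal_add_gaussianReal_of_indepFun
      (hind.indepFun_finsetSum_of_notMem hX hi).symm (hlaw i) (by simpa [Finset.sum_fn] using ih)
    simpa [Finset.sum_insert hi, Finset.sum_fn, Pi.add_def] using h

/-! ### One layer applied to a vector -/

/-- The rows of a random matrix with independent entries are independent. -/
theorem iIndepFun_rows {Ω ι κ : Type*} [Countable ι] [Countable κ] [MeasurableSpace Ω]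
    {P : Measure Ω} {X : ι → κ → Ω → ℝ} (hX : ∀ i j, Measurable (X i j))
    (hind : iIndepFun (fun e : ι × κ => X e.1 e.2) P) :
    iIndepFun (fun i ω j => X i j ω) P := by
  have := hind.isProbabilityMeasure
  have : ∀ i j, IsProbabilityMeasure (P.map (X i j)) := fun i j =>
    Measure.isProbabilityMeasure_map (hX i j).aemeasurable
  have hrow : ∀ i, P.map (fun ω j => X i j ω) = Measure.infinitePi fun j => P.map (X i j) := fun i =>
    (hind.precomp (g := fun j => (i, j)) (Prod.mk_right_injective i)).map_fun_eq_infinitePi_map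
      (hX i)
  rw [iIndepFun_iff_map_fun_eq_infinitePi_map fun i => measurable_pi_iff.2 (hX i)]
  simp_rw [hrow]
  have h := hind.map_fun_eq_infinitePi_map fun e : ι × κ => hX e.1 e.2
  rw [← Measure.infinitePi_map_curry fun i j => P.map (X i j), ← h,
    Measure.map_map (MeasurableEquiv.measurable _)
      (measurable_pi_iff.2 fun e : ι × κ => hX e.1 e.2)]
  rfl

/-- Rotation invariance: the scalar product of a vector of independent `N(0, v)` variables with a
unit vector has law `N(0, v)`. -/
theorem map_sum_mul_eq_gaussianReal {Ω ι : Type*} [Fintype ι] [MeasurableSpace Ω] {P : Measure Ω}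
    {X : ι → Ω → ℝ} {v : ℝ≥0} (hX : ∀ i, Measurable (X i))
    (hlaw : ∀ i, P.map (X i) = gaussianReal 0 v) (hind : iIndepFun X P) {u : ι → ℝ}
    (hu : ∑ i, u i ^ 2 = 1) :
    P.map (fun ω => ∑ i, X i ω * u i) = gaussianReal 0 v := by
  have := hind.isProbabilityMeasure
  have h := map_sum_eq_gaussianReal (X := fun i ω => X i ω * u i) (P := P)
    (v := fun i => .mk (u i ^ 2) (sq_nonneg _) * v) (fun i => (hX i).mul_const _)
    (fun i => by
      simpa using (gaussianReal_mul_const ⟨(hX i).aemeasurable, hlaw i⟩ (u i)).map_eq)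
    (hind.comp (fun i x => x * u i) fun i => measurable_id.mul_const _) Finset.univ
  rw [h, ← Finset.sum_mul]
  congr 1
  ext
  simp [hu]

section OneLayer

variable {Ω ι : Type*} [Fintype ι] [MeasurableSpace Ω] {P : Measure Ω}

/-- The moment of order `2 * p` of `‖(I + τ G) u‖` for a unit vector `u` and a matrix `G` with
independent `N(0, v)` entries. As `‖(I + τ G) u‖ ^ 2` is `1` plus a sum of functions of the single
coordinates of `G u`, the inequality `1 + s ≤ exp s` turns its power into a product of independent
factors. -/
theorem lintegral_normSq_pow_le_of_unit {G : ι → ι → Ω → ℝ} {v : ℝ≥0} (hv : v ≠ 0)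
    (hG : ∀ i j, Measurable (G i j)) (hlaw : ∀ i j, P.map (G i j) = gaussianReal 0 v)
    (hind : iIndepFun (fun e : ι × ι => G e.1 e.2) P) {τ : ℝ} {p : ℕ} (hp : p * τ ^ 2 * v ≤ 1 / 4)
    {u : ι → ℝ} (hu : ∑ i, u i ^ 2 = 1) :
    ∫⁻ ω, ENNReal.ofReal ((∑ i, (u i + τ * ∑ j, G i j ω * u j) ^ 2) ^ p) ∂P ≤
      ENNReal.ofReal
        (Real.exp (Fintype.card ι * (2 * (p * τ ^ 2 * v)) + 4 * p ^ 2 * τ ^ 2 * v)) := by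
  set Y : ι → Ω → ℝ := fun i ω => ∑ j, G i j ω * u j with hY
  have hYm : ∀ i, Measurable (Y i) := fun i =>
    Finset.measurable_fun_sum _ fun j _ => (hG i j).mul_const _
  have hYlaw : ∀ i, P.map (Y i) = gaussianReal 0 v := fun i =>
    map_sum_mul_eq_gaussianReal (hG i) (hlaw i)
      (hind.precomp (g := fun j => (i, j)) (Prod.mk_right_injective i)) hu
  have hYind : iIndepFun Y P :=
    (iIndepFun_rows hG hind).comp (fun _ x => ∑ j, x j * u j) fun _ => by fun_prop
  set f : ι → ℝ → ENNReal := fun i y =>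
    ENNReal.ofReal (Real.exp (2 * p * τ * u i * y + p * τ ^ 2 * y ^ 2)) with hf
  have hfm : ∀ i, Measurable (f i) := fun i => by fun_prop
  calc ∫⁻ ω, ENNReal.ofReal ((∑ i, (u i + τ * Y i ω) ^ 2) ^ p) ∂P
      ≤ ∫⁻ ω, ∏ i, f i (Y i ω) ∂P := by
        refine lintegral_mono fun ω => ?_
        rw [hf, ← ENNReal.ofReal_prod_of_nonneg fun i _ => (Real.exp_pos _).le, ← Real.exp_sum]
        apply ENNReal.ofReal_le_ofReal
        have hx : ∑ i, (u i + τ * Y i ω) ^ 2 =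
            1 + ∑ i, (2 * τ * u i * Y i ω + τ ^ 2 * Y i ω ^ 2) := by
          rw [← hu, ← Finset.sum_add_distrib]
          exact Finset.sum_congr rfl fun i _ => by ring
        calc (∑ i, (u i + τ * Y i ω) ^ 2) ^ p
            ≤ Real.exp (∑ i, (2 * τ * u i * Y i ω + τ ^ 2 * Y i ω ^ 2)) ^ p := by
              refine pow_le_pow_left₀ (Finset.sum_nonneg fun i _ => sq_nonneg _) ?_ p
              rw [hx, add_comm]
              exact Real.add_one_le_exp _
          _ = _ := by
              rw [← Real.exp_nat_mul, Finset.mul_sum]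
              congr 1
              exact Finset.sum_congr rfl fun i _ => by ring
    _ = ∏ i, ∫⁻ y, f i y ∂gaussianReal 0 v := by
        refine (lintegral_prod_eq_prod_lintegral_of_indepFun _ _ (hYind.comp f hfm)
          fun i => (hfm i).comp (hYm i)).trans ?_
        refine Finset.prod_congr rfl fun i _ => ?_
        rw [← hYlaw i, lintegral_map (hfm i) (hYm i)]
        rfl
    _ ≤ ∏ i, ENNReal.ofReal (Real.exp (2 * (p * τ ^ 2 * v) + (2 * p * τ * u i) ^ 2 * v)) :=
        Finset.prod_le_prod' fun i _ =>
          lintegral_exp_linear_add_sq_gaussianReal_le hv _ _ (by positivity) hp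
    _ = _ := by
        rw [← ENNReal.ofReal_prod_of_nonneg fun i _ => (Real.exp_pos _).le, ← Real.exp_sum,
          Finset.sum_add_distrib]
        have : ∑ i, (2 * p * τ * u i) ^ 2 * v = 4 * p ^ 2 * τ ^ 2 * v * ∑ i, u i ^ 2 := by
          rw [Finset.mul_sum]
          exact Finset.sum_congr rfl fun i _ => by ring
        rw [this, hu]
        simp

/-- The moment of order `2 * p` of `‖(I + τ G) x‖` for a fixed vector `x`, by homogeneity. -/
theorem lintegral_normSq_pow_le {G : ι → ι → Ω → ℝ} {v : ℝ≥0} (hv : v ≠ 0)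
    (hG : ∀ i j, Measurable (G i j)) (hlaw : ∀ i j, P.map (G i j) = gaussianReal 0 v)
    (hind : iIndepFun (fun e : ι × ι => G e.1 e.2) P) {τ : ℝ} {p : ℕ} (hp0 : p ≠ 0)
    (hp : p * τ ^ 2 * v ≤ 1 / 4) (x : ι → ℝ) :
    ∫⁻ ω, ENNReal.ofReal ((∑ i, (x i + τ * ∑ j, G i j ω * x j) ^ 2) ^ p) ∂P ≤
      ENNReal.ofReal
        (Real.exp (Fintype.card ι * (2 * (p * τ ^ 2 * v)) + 4 * p ^ 2 * τ ^ 2 * v)) *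
      ENNReal.ofReal ((∑ i, x i ^ 2) ^ p) := by
  have hS : 0 ≤ ∑ i, x i ^ 2 := Finset.sum_nonneg fun i _ => sq_nonneg _
  rcases hS.eq_or_lt with h0 | hpos
  · have hx : ∀ i, x i = 0 := fun i => by
      have := (Finset.sum_eq_zero_iff_of_nonneg fun i _ => sq_nonneg (x i)).1 h0.symm i
        (Finset.mem_univ i)
      simpa using this
    simp [hx, hp0]
  · set r := √(∑ i, x i ^ 2) with hr
    have hr0 : 0 < r := Real.sqrt_pos.2 hpos
    have hr2 : r ^ 2 = ∑ i, x i ^ 2 := Real.sq_sqrt hS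
    have hu : ∑ i, (x i / r) ^ 2 = 1 := by
      simp_rw [div_pow]
      rw [← Finset.sum_div, hr2, div_self hpos.ne']
    have key := lintegral_normSq_pow_le_of_unit hv hG hlaw hind hp hu
    have hscale : ∀ ω, ENNReal.ofReal ((∑ i, (x i + τ * ∑ j, G i j ω * x j) ^ 2) ^ p) =
        ENNReal.ofReal ((∑ i, (x i / r + τ * ∑ j, G i j ω * (x j / r)) ^ 2) ^ p) *
          ENNReal.ofReal ((∑ i, x i ^ 2) ^ p) := fun ω => by
      rw [← ENNReal.ofReal_mul (by positivity), ← mul_pow, ← hr2, Finset.sum_mul]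
      congr 2
      refine Finset.sum_congr rfl fun i _ => ?_
      simp_rw [← mul_div_assoc]
      rw [← Finset.sum_div]
      field_simp
    simp_rw [hscale]
    rw [lintegral_mul_const' _ _ ENNReal.ofReal_ne_top]
    gcongr

/-- The moment of order `2 * p` of `‖(I + τ G) h‖` for a random vector `h` independent of `G`. -/
theorem lintegral_normSq_pow_le_of_indepFun {G : ι → ι → Ω → ℝ} {v : ℝ≥0} (hv : v ≠ 0)
    (hG : ∀ i j, Measurable (G i j)) (hlaw : ∀ i j, P.map (G i j) = gaussianReal 0 v)
    (hind : iIndepFun (fun e : ι × ι => G e.1 e.2) P) {τ : ℝ} {p : ℕ} (hp0 : p ≠ 0)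
    (hp : p * τ ^ 2 * v ≤ 1 / 4) {h : Ω → ι → ℝ} (hh : Measurable h)
    (hhG : IndepFun h (fun ω i j => G i j ω) P) :
    ∫⁻ ω, ENNReal.ofReal ((∑ i, (h ω i + τ * ∑ j, G i j ω * h ω j) ^ 2) ^ p) ∂P ≤
      ENNReal.ofReal
        (Real.exp (Fintype.card ι * (2 * (p * τ ^ 2 * v)) + 4 * p ^ 2 * τ ^ 2 * v)) *
      ∫⁻ ω, ENNReal.ofReal ((∑ i, h ω i ^ 2) ^ p) ∂P := by
  have := hind.isProbabilityMeasure
  have hGm : Measurable fun ω i j => G i j ω :=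
    measurable_pi_iff.2 fun i => measurable_pi_iff.2 fun j => hG i j
  have hjoint := (indepFun_iff_map_prod_eq_prod_map_map hh.aemeasurable hGm.aemeasurable).1 hhG
  set F : (ι → ℝ) × (ι → ι → ℝ) → ENNReal := fun z =>
    ENNReal.ofReal ((∑ i, (z.1 i + τ * ∑ j, z.2 i j * z.1 j) ^ 2) ^ p) with hF
  have hFm : Measurable F := by fun_prop
  calc ∫⁻ ω, F (h ω, fun i j => G i j ω) ∂P
      = ∫⁻ z, F z ∂P.map (fun ω => (h ω, fun i j => G i j ω)) :=
        (lintegral_map hFm (hh.prodMk hGm)).symm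
    _ = ∫⁻ x, ∫⁻ ω, F (x, fun i j => G i j ω) ∂P ∂P.map h := by
        rw [hjoint, lintegral_prod _ hFm.aemeasurable]
        refine lintegral_congr fun x => ?_
        exact lintegral_map (hFm.comp measurable_prodMk_left) hGm
    _ ≤ ∫⁻ x, _ * ENNReal.ofReal ((∑ i, x i ^ 2) ^ p) ∂P.map h :=
        lintegral_mono fun x => lintegral_normSq_pow_le hv hG hlaw hind hp0 hp x
    _ = _ := by
        rw [lintegral_const_mul' _ _ ENNReal.ofReal_ne_top, lintegral_map (by fun_prop) hh]

end OneLayer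

/-! ### Moments of the product applied to a vector -/

theorem measurable_resProd_apply {Ω : Type*} [MeasurableSpace Ω] {m : ℕ} (τ : ℝ)
    {W D : ℕ → Ω → Matrix (Fin m) (Fin m) ℝ} {a : ℕ} (b : ℕ)
    (hW : ∀ k ∈ Set.Icc 1 b, ∀ i j, Measurable fun ω => W k ω i j)
    (hD : ∀ k ∈ Set.Icc 1 b, ∀ i j, Measurable fun ω => D k ω i j) (i j : Fin m) :
    Measurable fun ω => resProd τ (fun l => D l ω) (fun l => W l ω) a b i j := by
  induction b generalizing i j with
  | zero => simp [resProd]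
  | succ b ih =>
    have hsub : ∀ k ∈ Set.Icc 1 b, k ∈ Set.Icc 1 (b + 1) := fun k hk => ⟨hk.1, hk.2.trans b.le_succ⟩
    have hR := ih (fun k hk => hW k (hsub k hk)) fun k hk => hD k (hsub k hk)
    have hW' := hW (b + 1) ⟨by omega, le_rfl⟩
    have hD' := hD (b + 1) ⟨by omega, le_rfl⟩
    by_cases hab : a ≤ b + 1
    · simp only [resProd, if_pos hab, Matrix.mul_apply, Matrix.add_apply, Matrix.smul_apply,
        smul_eq_mul]
      fun_prop
    · simp [resProd, if_neg hab]

theorem measurable_resProd_mulVec {Ω : Type*} [MeasurableSpace Ω] {m : ℕ} (τ : ℝ)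
    {W D : ℕ → Ω → Matrix (Fin m) (Fin m) ℝ} {a : ℕ} (b : ℕ)
    (hW : ∀ k ∈ Set.Icc 1 b, ∀ i j, Measurable fun ω => W k ω i j)
    (hD : ∀ k ∈ Set.Icc 1 b, ∀ i j, Measurable fun ω => D k ω i j) (x : Fin m → ℝ) :
    Measurable fun ω => (resProd τ (fun l => D l ω) (fun l => W l ω) a b).mulVec x :=
  measurable_pi_iff.2 fun i => by
    simp only [Matrix.mulVec, dotProduct]
    exact Finset.measurable_fun_sum _ fun j _ =>
      (measurable_resProd_apply τ b hW hD i j).mul_const _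

/-- As no `D_l` looks ahead, the product of the first `b` layers is independent of the weights of
layer `b + 1`. -/
theorem IsAdaptedDiag.indepFun_resProd_mulVec {Ω : Type*} [MeasurableSpace Ω] {P : Measure Ω}
    [IsProbabilityMeasure P] {L m : ℕ} {W D : ℕ → Ω → Matrix (Fin m) (Fin m) ℝ}
    (hD : IsAdaptedDiag P L m W D) (τ : ℝ) (a : ℕ) {b : ℕ} (hb : b + 1 ≤ L) (x : Fin m → ℝ) :
    IndepFun (fun ω => (resProd τ (fun l => D l ω) (fun l => W l ω) a b).mulVec x)
      (fun ω i j => W (b + 1) ω i j) P := by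
  rcases Nat.eq_zero_or_pos b with rfl | hb0
  · simp only [resProd, Matrix.one_mulVec]
    exact indepFun_const_left x _
  have h := (hD.indep b ⟨hb0, by omega⟩).comp measurable_id
    (measurable_pi_apply (⟨b + 1, by simp; omega⟩ : Set.Ioc b L))
  rw [IndepFun_iff_Indep] at h ⊢
  refine indep_of_indep_of_le_left h (Measurable.comap_le ?_)
  -- The product up to layer `b` is measurable for the σ-algebra of the first `b` layers.
  set past := fun ω => ((fun (k : Set.Icc 1 b) (i j : Fin m) => W k ω i j),
        (fun (k : Set.Icc 1 b) (i j : Fin m) => D k ω i j))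
  have hm : Measurable[MeasurableSpace.comap (id ∘ past) inferInstance] past :=
    comap_measurable past
  refine @measurable_resProd_mulVec Ω (MeasurableSpace.comap (id ∘ past) inferInstance) m τ W D a b
    (fun k hk i j => ?_) (fun k hk i j => ?_) x
  · have : Measurable fun z : (Set.Icc 1 b → Fin m → Fin m → ℝ) × (Set.Icc 1 b → Fin m → Fin m → ℝ) =>
      z.1 ⟨k, hk⟩ i j := by fun_prop
    exact this.comp hm
  · have : Measurable fun z : (Set.Icc 1 b → Fin m → Fin m → ℝ) × (Set.Icc 1 b → Fin m → Fin m → ℝ) =>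
      z.2 ⟨k, hk⟩ i j := by fun_prop
    exact this.comp hm

theorem norm_toEuclideanCLM_sq {m : ℕ} (A : Matrix (Fin m) (Fin m) ℝ)
    (x : EuclideanSpace ℝ (Fin m)) :
    ‖Matrix.toEuclideanCLM (n := Fin m) (𝕜 := ℝ) A x‖ ^ 2 = ∑ i, A.mulVec x i ^ 2 := by
  simp [EuclideanSpace.norm_sq_eq]

/-- Each layer multiplies the moment of order `2 * m * q` by at most
`exp (m (4 q + 8 q ^ 2) τ ^ 2)`. -/
theorem lintegral_norm_resProd_pow_le {Ω : Type*} [MeasurableSpace Ω] {P : Measure Ω}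
    [IsProbabilityMeasure P] {L m : ℕ} (hm : 1 ≤ m) {W D : ℕ → Ω → Matrix (Fin m) (Fin m) ℝ}
    (hW : IsGaussianInit P L m W) (hD : IsAdaptedDiag P L m W D) {τ : ℝ} {q : ℕ} (hq0 : q ≠ 0)
    (hq : 8 * q * τ ^ 2 ≤ 1) (a : ℕ) {b : ℕ} (hb : b ≤ L) (x : EuclideanSpace ℝ (Fin m)) :
    ∫⁻ ω, ENNReal.ofReal ((‖Matrix.toEuclideanCLM (n := Fin m) (𝕜 := ℝ)
        (resProd τ (fun l => D l ω) (fun l => W l ω) a b) x‖ ^ 2) ^ (m * q)) ∂P ≤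
      ENNReal.ofReal (Real.exp (m * (b * ((4 * q + 8 * q ^ 2) * τ ^ 2)))) *
        ENNReal.ofReal ((‖x‖ ^ 2) ^ (m * q)) := by
  have hm0 : (m : ℝ) ≠ 0 := by positivity
  induction b with
  | zero => simp [resProd]
  | succ b ih =>
    by_cases hab : a ≤ b + 1
    swap
    · simp only [resProd, if_neg hab, map_one, one_apply_eq_self, lintegral_const,
        measure_univ, mul_one]
      refine le_mul_of_one_le_left' ?_
      rw [← ENNReal.ofReal_one]
      exact ENNReal.ofReal_le_ofReal (Real.one_le_exp (by positivity))
    have hmem : b + 1 ∈ Set.Icc 1 L := ⟨by omega, hb⟩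
    have hmem' : ∀ k ∈ Set.Icc 1 b, k ∈ Set.Icc 1 L := fun k hk => ⟨hk.1, by have := hk.2; omega⟩
    have hind : iIndepFun (fun (e : Fin m × Fin m) ω => W (b + 1) ω e.1 e.2) P :=
      hW.indep.precomp (g := fun e : Fin m × Fin m => ((⟨b + 1, hmem⟩ : Set.Icc 1 L), e))
        (Prod.mk_right_injective _)
    set h : Ω → Fin m → ℝ := fun ω =>
      (resProd τ (fun l => D l ω) (fun l => W l ω) a b).mulVec x
    have hhm : Measurable h := measurable_resProd_mulVec τ b
      (fun k hk => hW.measurable k (hmem' k hk)) (fun k hk => hD.measurable k (hmem' k hk)) _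
    have hv : (2 / (m : ℝ≥0)) ≠ 0 := by positivity
    have hstep := lintegral_normSq_pow_le_of_indepFun (G := fun i j ω => W (b + 1) ω i j) hv
      (hW.measurable _ hmem) (hW.law _ hmem) hind (τ := τ) (p := m * q) (by positivity)
      (by push_cast; field_simp; linarith) hhm (hD.indepFun_resProd_mulVec τ a hb x)
    have hle : ∀ᵐ ω ∂P, ‖Matrix.toEuclideanCLM (n := Fin m) (𝕜 := ℝ)
        (resProd τ (fun l => D l ω) (fun l => W l ω) a (b + 1)) x‖ ^ 2 ≤
          ∑ i, (h ω i + τ * ∑ j, W (b + 1) ω i j * h ω j) ^ 2 := by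
      filter_upwards [hD.norm_le _ hmem] with ω hω
      set A : Matrix (Fin m) (Fin m) ℝ :=
        (1 + τ • W (b + 1) ω) * resProd τ (fun l => D l ω) (fun l => W l ω) a b with hA
      have h1 : ‖Matrix.toEuclideanCLM (n := Fin m) (𝕜 := ℝ) (D (b + 1) ω * A) x‖ ≤
          ‖Matrix.toEuclideanCLM (n := Fin m) (𝕜 := ℝ) A x‖ := by
        rw [map_mul, mul_apply_eq_comp]
        exact (ContinuousLinearMap.le_of_opNorm_le _ hω _).trans_eq (one_mul _)
      simp only [resProd, if_pos hab, mul_assoc]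
      refine (pow_le_pow_left₀ (norm_nonneg _) h1 2).trans_eq ?_
      rw [norm_toEuclideanCLM_sq, hA, ← Matrix.mulVec_mulVec, Matrix.add_mulVec,
        Matrix.one_mulVec, Matrix.smul_mulVec]
      rfl
    refine (lintegral_mono_ae (hle.mono fun ω hω =>
      ENNReal.ofReal_le_ofReal (pow_le_pow_left₀ (sq_nonneg _) hω _))).trans (hstep.trans ?_)
    have hih := ih (by omega)
    simp only [norm_toEuclideanCLM_sq] at hih
    refine (mul_le_mul_right hih _).trans_eq ?_
    rw [← mul_assoc, ← ENNReal.ofReal_mul (Real.exp_pos _).le, ← Real.exp_add]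
    congr 3
    push_cast
    simp only [Fintype.card_fin]
    field_simp
    ring

/-! ### From fixed vectors to the spectral norm -/

/-- The high moments of `‖T x‖` over the unit ball detect the operator norm: next to a vector where
`T` almost attains its norm there is a ball of radius `ε`, contained in the unit ball, on which
`‖T x‖ ≥ (1 - 3 ε) ‖T‖`. -/
theorem le_lintegral_closedBall_norm_pow {E : Type*} [NormedAddCommGroup E] [NormedSpace ℝ E]
    [FiniteDimensional ℝ E] [MeasurableSpace E] [BorelSpace E] (μ : Measure E) [μ.IsAddHaarMeasure]
    (T : E →L[ℝ] E) {ε r : ℝ} (hε0 : 0 < ε) (hε1 : 3 * ε ≤ 1) (hr0 : 0 < r) (hr : r ≤ ‖T‖) (n : ℕ) :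
    ENNReal.ofReal (ε ^ Module.finrank ℝ E * (((1 - 3 * ε) * r) ^ 2) ^ n) *
        μ (Metric.closedBall 0 1) ≤
      ∫⁻ x in Metric.closedBall 0 1, ENNReal.ofReal ((‖T x‖ ^ 2) ^ n) ∂μ := by
  have hT : 0 < ‖T‖ := hr0.trans_le hr
  obtain ⟨u, hu1, hu⟩ := T.exists_lt_apply_of_lt_opNorm (r := (1 - ε) * ‖T‖) (by nlinarith)
  have hsub : Metric.closedBall ((1 - ε) • u) ε ⊆ Metric.closedBall 0 1 := by
    refine Metric.closedBall_subset_closedBall' ?_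
    rw [dist_zero_right, norm_smul, Real.norm_of_nonneg (by linarith)]
    nlinarith
  have hlow : ∀ x ∈ Metric.closedBall ((1 - ε) • u) ε, (1 - 3 * ε) * r ≤ ‖T x‖ := by
    intro x hx
    have h1 : ‖T ((1 - ε) • u)‖ = (1 - ε) * ‖T u‖ := by
      rw [map_smul, norm_smul, Real.norm_of_nonneg (by linarith)]
    have h2 : ‖T ((1 - ε) • u) - T x‖ ≤ ‖T‖ * ε := by
      rw [← map_sub]
      refine T.le_opNorm_of_le ?_
      rw [← dist_eq_norm, dist_comm]
      exact hx
    have h3 := norm_sub_norm_le (T ((1 - ε) • u)) (T x)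
    have h4 : (1 - ε) * ((1 - ε) * ‖T‖) ≤ (1 - ε) * ‖T u‖ :=
      mul_le_mul_of_nonneg_left hu.le (by linarith)
    have h5 : (1 - 3 * ε) * r ≤ (1 - 3 * ε) * ‖T‖ := mul_le_mul_of_nonneg_left hr (by linarith)
    nlinarith [mul_nonneg (sq_nonneg ε) hT.le]
  calc _ = ∫⁻ _ in Metric.closedBall ((1 - ε) • u) ε,
        ENNReal.ofReal ((((1 - 3 * ε) * r) ^ 2) ^ n) ∂μ := by
        rw [setLIntegral_const, Measure.addHaar_closedBall' μ _ hε0.le,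
          ENNReal.ofReal_mul (by positivity)]
        ring
    _ ≤ ∫⁻ x in Metric.closedBall ((1 - ε) • u) ε, ENNReal.ofReal ((‖T x‖ ^ 2) ^ n) ∂μ := by
        refine setLIntegral_mono' measurableSet_closedBall fun x hx => ENNReal.ofReal_le_ofReal ?_
        have h0 : 0 ≤ (1 - 3 * ε) * r := mul_nonneg (by linarith) hr0.le
        gcongr
        exact hlow x hx
    _ ≤ _ := lintegral_mono_set hsub

/-- If the images of all vectors of the unit ball under a random matrix have a moment of order
`2 * n` at most `K`, then its spectral norm is rarely large: Markov's inequality for the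
moment averaged over the unit ball. -/
theorem mul_measure_specNorm_gt_le {Ω : Type*} [MeasurableSpace Ω] {P : Measure Ω}
    [IsProbabilityMeasure P] {m : ℕ} {A : Ω → Matrix (Fin m) (Fin m) ℝ}
    (hA : ∀ i j, Measurable fun ω => A ω i j) {n : ℕ} {K : ENNReal}
    (hK : ∀ x ∈ Metric.closedBall (0 : EuclideanSpace ℝ (Fin m)) 1, ∫⁻ ω, ENNReal.ofReal
      ((‖Matrix.toEuclideanCLM (n := Fin m) (𝕜 := ℝ) (A ω) x‖ ^ 2) ^ n) ∂P ≤ K)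
    {ε r : ℝ} (hε0 : 0 < ε) (hε1 : 3 * ε ≤ 1) (hr0 : 0 < r) :
    ENNReal.ofReal (ε ^ m * (((1 - 3 * ε) * r) ^ 2) ^ n) * P {ω | r < specNorm (A ω)} ≤ K := by
  set V : ENNReal := volume (Metric.closedBall (0 : EuclideanSpace ℝ (Fin m)) 1) with hV
  have hV0 : V ≠ 0 := (Metric.measure_closedBall_pos _ _ one_pos).ne'
  have hVtop : V ≠ ⊤ := measure_closedBall_lt_top.ne
  set F : Ω → EuclideanSpace ℝ (Fin m) → ENNReal := fun ω x => ENNReal.ofReal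
    ((‖Matrix.toEuclideanCLM (n := Fin m) (𝕜 := ℝ) (A ω) x‖ ^ 2) ^ n) with hF
  have hFm : Measurable (Function.uncurry F) := by
    simp only [hF, norm_toEuclideanCLM_sq, Matrix.mulVec, dotProduct, Function.uncurry_def]
    have : ∀ i j, Measurable fun z : Ω × EuclideanSpace ℝ (Fin m) => A z.1 i j := fun i j =>
      (hA i j).comp measurable_fst
    fun_prop
  set B : ENNReal := ENNReal.ofReal (ε ^ m * (((1 - 3 * ε) * r) ^ 2) ^ n) with hB
  have hmarkov : B * V * P {ω | r < specNorm (A ω)} ≤ K * V :=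
    calc B * V * P {ω | r < specNorm (A ω)}
        ≤ B * V * P {ω | B * V ≤ ∫⁻ x in Metric.closedBall 0 1, F ω x} := by
          gcongr with ω
          intro hω
          have := le_lintegral_closedBall_norm_pow volume
            (Matrix.toEuclideanCLM (n := Fin m) (𝕜 := ℝ) (A ω)) hε0 hε1 hr0 (le_of_lt hω) n
          rwa [finrank_euclideanSpace_fin] at this
      _ ≤ ∫⁻ ω, ∫⁻ x in Metric.closedBall 0 1, F ω x ∂volume ∂P :=
          mul_meas_ge_le_lintegral₀ hFm.lintegral_prod_right'.aemeasurable _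
      _ = ∫⁻ x in Metric.closedBall 0 1, ∫⁻ ω, F ω x ∂P :=
          lintegral_lintegral_swap hFm.aemeasurable
      _ ≤ ∫⁻ _ in Metric.closedBall (0 : EuclideanSpace ℝ (Fin m)) 1, K :=
          setLIntegral_mono' measurableSet_closedBall hK
      _ = K * V := setLIntegral_const _ _
  -- The volume of the unit ball cancels.
  rw [mul_right_comm] at hmarkov
  exact (ENNReal.mul_le_mul_iff_left hV0 hVtop).1 hmarkov

/-- In the exponent `1 + t` of the hypothesis `ht`, the summand `1` absorbs the bound `exp m` on the
moments and `t` is the gain. -/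
theorem measure_specNorm_resProd_gt_le {Ω : Type*} [MeasurableSpace Ω] {P : Measure Ω}
    [IsProbabilityMeasure P] {L m : ℕ} (hm : 1 ≤ m) {W D : ℕ → Ω → Matrix (Fin m) (Fin m) ℝ}
    (hW : IsGaussianInit P L m W) (hD : IsAdaptedDiag P L m W D) {τ : ℝ} {q : ℕ} (hq0 : q ≠ 0)
    (hq : 8 * q * τ ^ 2 ≤ 1) (hL : L * ((4 * q + 8 * q ^ 2) * τ ^ 2) ≤ 1)
    {ε r t : ℝ} (hε0 : 0 < ε) (hε1 : 3 * ε ≤ 1) (hr0 : 0 < r)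
    (ht : Real.exp (1 + t) ≤ ε * (((1 - 3 * ε) * r) ^ 2) ^ q) (a : ℕ) {b : ℕ} (hb : b ≤ L) :
    P {ω | r < specNorm (resProd τ (fun l => D l ω) (fun l => W l ω) a b)} ≤
      ENNReal.ofReal (Real.exp (-(m * t))) := by
  have hmem : ∀ k ∈ Set.Icc 1 b, k ∈ Set.Icc 1 L := fun k hk => ⟨hk.1, hk.2.trans hb⟩
  have key := mul_measure_specNorm_gt_le (P := P) (n := m * q) (K := ENNReal.ofReal (Real.exp m))
    (measurable_resProd_apply τ (a := a) b
      (fun k hk => hW.measurable k (hmem k hk)) fun k hk => hD.measurable k (hmem k hk))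
    (fun x hx => by
      refine (lintegral_norm_resProd_pow_le hm hW hD hq0 hq a hb x).trans ?_
      rw [← ENNReal.ofReal_mul (Real.exp_pos _).le]
      apply ENNReal.ofReal_le_ofReal
      refine (mul_le_of_le_one_right (Real.exp_pos _).le ?_).trans (Real.exp_le_exp.2 ?_)
      · exact pow_le_one₀ (sq_nonneg _) (pow_le_one₀ (norm_nonneg _) (by simpa using hx))
      · refine mul_le_of_le_one_right (by positivity) (le_trans ?_ hL)
        gcongr)
    hε0 hε1 hr0
  set p := P {ω | r < specNorm (resProd τ (fun l => D l ω) (fun l => W l ω) a b)}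
  have h1 : ENNReal.ofReal (Real.exp (m * (1 + t))) * p ≤ ENNReal.ofReal (Real.exp m) := by
    refine le_trans ?_ key
    gcongr
    rw [Real.exp_nat_mul, mul_comm m q, pow_mul, ← mul_pow]
    gcongr
  calc p = ENNReal.ofReal (Real.exp (-(m * (1 + t)))) *
        (ENNReal.ofReal (Real.exp (m * (1 + t))) * p) := by
        rw [← mul_assoc, ← ENNReal.ofReal_mul (Real.exp_pos _).le, ← Real.exp_add]
        simp
    _ ≤ ENNReal.ofReal (Real.exp (-(m * (1 + t)))) * ENNReal.ofReal (Real.exp m) := by gcongr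
    _ = _ := by
        rw [← ENNReal.ofReal_mul (Real.exp_pos _).le, ← Real.exp_add]
        congr 2
        ring

theorem mainTheorem5 :
    ∃ κ : ℝ, 0 < κ ∧ ∀ c : ℝ, 0 < c → ∃ C : ℝ, 0 < C ∧
      ∀ (m L : ℕ), 1 ≤ m → 1 ≤ L → ∀ τ : ℝ, 0 ≤ τ → τ ≤ 1 / (C * Real.sqrt L) →
      ∀ (Ω : Type*) [MeasurableSpace Ω] (P : Measure Ω) [IsProbabilityMeasure P]
        (W D : ℕ → Ω → Matrix (Fin m) (Fin m) ℝ),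
        IsGaussianInit P L m W → IsAdaptedDiag P L m W D →
        1 - (L : ℝ) ^ 2 * Real.exp (-(κ * m * c ^ 2)) ≤
          P.real {ω | ∀ a b : ℕ, 1 ≤ a → a ≤ b → b ≤ L →
            specNorm (resProd τ (fun l => D l ω) (fun l => W l ω) a b) ≤ 1 + c} := by
  refine ⟨1, one_pos, fun c hc => ?_⟩
  -- This `ε` turns `1 + c` into `(1 - 3 * ε) * (1 + c) = 1 + c / 2`, which is still above `1`.
  set ε : ℝ := c / (6 * (1 + c)) with hε
  have hε0 : 0 < ε := by positivity
  have hε1 : 3 * ε ≤ 1 := by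
    rw [hε, mul_div_assoc', div_le_one (by positivity)]
    linarith
  have hs : (1 - 3 * ε) * (1 + c) = 1 + c / 2 := by
    rw [hε]
    field_simp
    ring
  obtain ⟨q₀, hq₀⟩ := pow_unbounded_of_one_lt (Real.exp (1 + c ^ 2) / ε)
    (show 1 < (1 + c / 2) ^ 2 by nlinarith)
  set q := q₀ + 1 with hq
  have ht : Real.exp (1 + c ^ 2) ≤ ε * (((1 - 3 * ε) * (1 + c)) ^ 2) ^ q := by
    rw [hs, mul_comm, ← div_le_iff₀ hε0]
    exact hq₀.le.trans (pow_le_pow_right₀ (by nlinarith) (Nat.le_succ _))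
  -- Large enough for `8 q τ ^ 2 ≤ 1` and `L (4 q + 8 q ^ 2) τ ^ 2 ≤ 1`, since `C ≥ 1`.
  set C : ℝ := 8 * q + 8 * q ^ 2 with hC
  have hq1 : (1 : ℝ) ≤ q := by rw [hq]; push_cast; linarith [q₀.cast_nonneg (α := ℝ)]
  have hC1 : 1 ≤ C := by rw [hC]; nlinarith
  refine ⟨C, by positivity, fun m L hm hL τ hτ0 hτ Ω _ P _ W D hW hD => ?_⟩
  have hL1 : (1 : ℝ) ≤ L := by exact_mod_cast hL
  have hCL : C * (L * τ ^ 2) ≤ 1 := by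
    have h1 : C * √L * τ ≤ 1 := by
      rw [le_div_iff₀ (by positivity)] at hτ
      linarith
    have h2 : (C * √L * τ) ^ 2 ≤ 1 := pow_le_one₀ (by positivity) h1
    rw [mul_pow, mul_pow, Real.sq_sqrt (by positivity)] at h2
    refine le_trans ?_ h2
    rw [mul_assoc]
    exact mul_le_mul_of_nonneg_right (by nlinarith) (by positivity)
  have hLτ : τ ^ 2 ≤ L * τ ^ 2 := le_mul_of_one_le_left (sq_nonneg _) hL1
  have hq8 : 8 * q * τ ^ 2 ≤ 1 := by
    refine le_trans ?_ hCL
    gcongr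
    rw [hC]
    nlinarith
  have hqL : L * ((4 * q + 8 * q ^ 2) * τ ^ 2) ≤ 1 := by
    refine le_trans ?_ hCL
    rw [mul_left_comm]
    gcongr
    rw [hC]
    linarith
  set bad : ℕ → ℕ → Set Ω := fun a b =>
    {ω | 1 + c < specNorm (resProd τ (fun l => D l ω) (fun l => W l ω) a b)} with hbad
  have hp : ∀ a, ∀ b ∈ Finset.Icc 1 L, P.real (bad a b) ≤ Real.exp (-(m * c ^ 2)) := fun a b hb =>
    ENNReal.toReal_le_of_le_ofReal (Real.exp_pos _).le <|
      measure_specNorm_resProd_gt_le hm hW hD (Nat.succ_ne_zero _) hq8 hqL hε0 hε1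
        (by positivity) ht a (Finset.mem_Icc.1 hb).2
  set good : Set Ω := {ω | ∀ a b : ℕ, 1 ≤ a → a ≤ b → b ≤ L →
    specNorm (resProd τ (fun l => D l ω) (fun l => W l ω) a b) ≤ 1 + c} with hgood
  have hcover : (Set.univ : Set Ω) ⊆
      good ∪ ⋃ e ∈ Finset.Icc 1 L ×ˢ Finset.Icc 1 L, bad e.1 e.2 := by
    intro ω _
    by_cases hω : ω ∈ good
    · exact Or.inl hω
    · right
      simp only [hgood, Set.mem_ofPred_eq, not_forall, not_le] at hω
      obtain ⟨a, b, ha, hab, hb, hlt⟩ := hω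
      simp only [Set.mem_iUnion]
      exact ⟨(a, b), by simp; omega, hlt⟩
  have hunion : P.real (⋃ e ∈ Finset.Icc 1 L ×ˢ Finset.Icc 1 L, bad e.1 e.2) ≤
      (L : ℝ) ^ 2 * Real.exp (-(1 * m * c ^ 2)) :=
    calc _ ≤ ∑ e ∈ Finset.Icc 1 L ×ˢ Finset.Icc 1 L, P.real (bad e.1 e.2) :=
          measureReal_biUnion_finset_le _ _
      _ ≤ ∑ _e ∈ Finset.Icc 1 L ×ˢ Finset.Icc 1 L, Real.exp (-(m * c ^ 2)) :=
          Finset.sum_le_sum fun e he => hp _ _ (Finset.mem_product.1 he).2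
      _ = _ := by
          rw [Finset.sum_const, Finset.card_product, Nat.card_Icc, nsmul_eq_mul]
          push_cast
          simp [sq]
  have h1 : 1 ≤ P.real good + P.real (⋃ e ∈ Finset.Icc 1 L ×ˢ Finset.Icc 1 L, bad e.1 e.2) :=
    calc (1 : ℝ) = P.real Set.univ := by simp
      _ ≤ _ := measureReal_mono hcover
      _ ≤ _ := measureReal_union_le _ _
  linarith
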